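/- Let $\mathcal E$ and $\mathcal E'$ be two ellipses in the Euclidean plane (circles allowed, axes in arbitrary position) with a common center $O$, and suppose that the pair admits Poncelet 3-periodics, i.e. that there is a non-degenerate triangle inscribed in $\mathcal E$ and circumscribed about $\mathcal E'$ (its vertices lie on $\mathcal E$ and each of its three sides, as a segment, is tangent to $\mathcal E'$). For every such triangle $T=P_1P_2P_3$ there is exactly one anticevian triangle $P_1'P_2'P_3'$ of $T$ with respect to $O$, that is, a non-degenerate triangle such that, for each $i$, the point $P_i$ lies both on the line $P_i'O$ and on the side line of $P_1'P_2'P_3'$ opposite $P_i'$; and for each $i$ there is exactly one ellipse $\mathcal C_i'$ centered at $P_i'$ and passing through $P_1,P_2,P_3$. The total area $$\Sigma_O=\operatorname{area}(\mathcal C_1')+\operatorname{area}(\mathcal C_2')+\operatorname{area}(\mathcal C_3')$$ is the same for all triangles $T$ inscribed in $\mathcal E$ and circumscribed about $\mathcal E'$. -/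

import Mathlib

open scoped BigOperators

/-- The Euclidean plane. -/
abbrev Plane : Type := EuclideanSpace ℝ (Fin 2)

/-- An ellipse in the plane (circles included), not necessarily axis-aligned: a center `O` and a
positive definite quadratic form `Q (x, y) = a x ^ 2 + 2 b x y + c y ^ 2`. The ellipse is the curve
`Q (P - O) = 1`; every ellipse is given in this way by exactly one such datum. -/
@[ext]
structure Ellipse where
  center : Plane
  a : ℝ
  b : ℝ
  c : ℝ
  a_pos : 0 < a
  disc_pos : 0 < a * c - b ^ 2

namespace Ellipse

/-- The quadratic form of the ellipse, evaluated at `P - center`. -/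
def form (E : Ellipse) (P : Plane) : ℝ :=
  E.a * (P 0 - E.center 0) ^ 2 + 2 * E.b * (P 0 - E.center 0) * (P 1 - E.center 1)
    + E.c * (P 1 - E.center 1) ^ 2

/-- The ellipse as a curve. -/
def curve (E : Ellipse) : Set Plane := {P | E.form P = 1}

/-- The closed region bounded by the ellipse. -/
def region (E : Ellipse) : Set Plane := {P | E.form P ≤ 1}

/-- The area enclosed by the ellipse: the Lebesgue measure of the region it bounds. -/
noncomputable def area (E : Ellipse) : ℝ := MeasureTheory.volume.real E.region

end Ellipse

/-- The side `PQ` (a segment) is tangent to the ellipse: the line `PQ` meets the curve in exactly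
one point, and this point of contact lies on the segment `PQ`. -/
def SideTangent (E : Ellipse) (P Q : Plane) : Prop :=
  ∃ X ∈ segment ℝ P Q, (line[ℝ, P, Q] : Set Plane) ∩ E.curve = {X}

/-- The Poncelet 3-periodics of the pair `(E, E')`: the (nondegenerate) triangles inscribed in `E`
and circumscribed about `E'`. -/
def ponceletFamily (E E' : Ellipse) : Set (Affine.Triangle ℝ Plane) :=
  {T | (∀ i, T.points i ∈ E.curve) ∧
    ∀ i, SideTangent E' (T.points (i + 1)) (T.points (i + 2))}

/-- `T'` is the anticevian triangle of `T` with respect to `X`, that is, `T` is the cevian triangle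
of `X` with respect to `T'`: the `i`-th vertex of `T` is the point where the cevian of `T'` from
its `i`-th vertex through `X` meets the opposite side line of `T'`. -/
def IsAnticevian (T : Affine.Triangle ℝ Plane) (X : Plane) (T' : Affine.Triangle ℝ Plane) : Prop :=
  ∀ i, T.points i ∈ line[ℝ, T'.points i, X] ∧
    T.points i ∈ line[ℝ, T'.points (i + 1), T'.points (i + 2)]

/-- `C` is a circumellipse of `T` centered at `X`: it passes through the vertices of `T`. -/
def IsCircumellipse (T : Affine.Triangle ℝ Plane) (X : Plane) (C : Ellipse) : Prop :=
  C.center = X ∧ ∀ i, T.points i ∈ C.curve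

/-! Let (u, v, w) be the barycentric coordinates of O in T, D twice the signed area of T, and d, d'
the discriminants of E, E'. An ellipse has area a constant over the root of its discriminant
(`area_eq`). Seen from O, the vertices are unit vectors for the form of E with one linear relation,
which forces the form and gives d (2uvwD)² = (1-2u)(1-2v)(1-2w) (`disc_circumellipse`). Tangency of
the sides to E' gives 0 < u, v, w < 1/2 and d' D² (1-2u)(1-2v)(1-2w) = 4
(`inellipse_of_sideTangent`). The anticevian vertices are (-u : v : w) and its analogues. The first
formula, applied to such a center, shows that its circumellipse has area area(E)/(1-2u). Eliminating
D between the two formulas, the three factors sum to 1 + 2√(d'/d), which does not involve T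
(`sum_inv_eq`). -/

open MeasureTheory

/-! ### Area of an ellipse -/

namespace Ellipse

/-- The linear change of coordinates (a Cholesky factor) taking the form of `E` to the
standard one. -/
noncomputable def normalizer (E : Ellipse) : Plane →ₗ[ℝ] Plane :=
  Matrix.toLin (EuclideanSpace.basisFun (Fin 2) ℝ).toBasis (EuclideanSpace.basisFun (Fin 2) ℝ).toBasis
    !![√E.a, E.b / √E.a; 0, √((E.a * E.c - E.b ^ 2) / E.a)]

theorem normalizer_zero (E : Ellipse) (P : Plane) :
    E.normalizer P 0 = √E.a * P 0 + E.b / √E.a * P 1 := by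
  simp [normalizer, Matrix.toLin_apply, Matrix.mulVec, dotProduct, Fin.sum_univ_two]

theorem normalizer_one (E : Ellipse) (P : Plane) :
    E.normalizer P 1 = √((E.a * E.c - E.b ^ 2) / E.a) * P 1 := by
  simp [normalizer, Matrix.toLin_apply, Matrix.mulVec, dotProduct, Fin.sum_univ_two]

theorem det_normalizer (E : Ellipse) :
    LinearMap.det E.normalizer = √(E.a * E.c - E.b ^ 2) := by
  have ha := E.a_pos
  rw [normalizer, LinearMap.det_toLin, Matrix.det_fin_two_of, mul_zero, sub_zero,
    ← Real.sqrt_mul ha.le, mul_div_cancel₀ _ ha.ne']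

theorem normSq_normalizer (E : Ellipse) (P : Plane) :
    ‖E.normalizer (P - E.center)‖ ^ 2 = E.form P := by
  have ha := E.a_pos
  have hs : √E.a ≠ 0 := (Real.sqrt_pos.2 ha).ne'
  have h1 : √E.a ^ 2 = E.a := Real.sq_sqrt ha.le
  have h2 := Real.sq_sqrt (div_pos E.disc_pos ha).le
  rw [EuclideanSpace.norm_sq_eq, Fin.sum_univ_two, normalizer_zero, normalizer_one,
    Real.norm_eq_abs, Real.norm_eq_abs, sq_abs, sq_abs, mul_pow, h2, add_sq, mul_pow, mul_pow,
    div_pow, h1, form]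
  simp only [PiLp.sub_apply]
  field_simp
  ring

theorem region_eq_preimage (E : Ellipse) :
    E.region = (fun P => P - E.center) ⁻¹' (E.normalizer ⁻¹' Metric.closedBall 0 1) := by
  ext P
  simp only [region, Set.mem_ofPred_eq, Set.mem_preimage, mem_closedBall_zero_iff]
  rw [← normSq_normalizer, sq_le_one_iff₀ (norm_nonneg _)]

/-- The measure of the unit disk stays unevaluated, since only ratios of areas matter. -/
theorem area_eq (E : Ellipse) :
    E.area = volume.real (Metric.closedBall (0 : Plane) 1) / √(E.a * E.c - E.b ^ 2) := by
  have hd : 0 < √(E.a * E.c - E.b ^ 2) := Real.sqrt_pos.2 E.disc_pos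
  rw [area, Measure.real, region_eq_preimage]
  simp only [sub_eq_add_neg _ E.center]
  rw [measure_preimage_add_right,
    Measure.addHaar_preimage_linearMap _ (by rw [det_normalizer]; exact hd.ne'), det_normalizer,
    ENNReal.toReal_mul, ENNReal.toReal_ofReal (abs_nonneg _), abs_of_pos (inv_pos.2 hd),
    inv_mul_eq_div, Measure.real]

end Ellipse

/-! ### Binary quadratic forms with prescribed unit vectors -/

/-- The coefficients of a binary quadratic form are determined by its Gram matrix on a basis. -/
theorem quadratic_coeffs (a b c x y z t : ℝ) :
    (x * t - y * z) ^ 2 * a = t ^ 2 * (a * x ^ 2 + 2 * b * x * y + c * y ^ 2)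
      + y ^ 2 * (a * z ^ 2 + 2 * b * z * t + c * t ^ 2)
      - 2 * (a * x * z + b * (x * t + y * z) + c * y * t) * y * t ∧
    (x * t - y * z) ^ 2 * b = -(z * t * (a * x ^ 2 + 2 * b * x * y + c * y ^ 2)
      + x * y * (a * z ^ 2 + 2 * b * z * t + c * t ^ 2))
      + (a * x * z + b * (x * t + y * z) + c * y * t) * (x * t + y * z) ∧
    (x * t - y * z) ^ 2 * c = z ^ 2 * (a * x ^ 2 + 2 * b * x * y + c * y ^ 2)
      + x ^ 2 * (a * z ^ 2 + 2 * b * z * t + c * t ^ 2)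
      - 2 * (a * x * z + b * (x * t + y * z) + c * y * t) * x * z :=
  ⟨by ring, by ring, by ring⟩

theorem quadratic_gram_det (a b c x y z t : ℝ) :
    (a * c - b ^ 2) * (x * t - y * z) ^ 2 =
      (a * x ^ 2 + 2 * b * x * y + c * y ^ 2) * (a * z ^ 2 + 2 * b * z * t + c * t ^ 2)
      - (a * x * z + b * (x * t + y * z) + c * y * t) ^ 2 := by
  ring

/-- Polarization for unit vectors with a linear relation. -/
theorem two_mul_polar_of_unit {a b c u v w x₁ y₁ x₂ y₂ x₃ y₃ : ℝ}
    (hx : u * x₁ + v * x₂ + w * x₃ = 0) (hy : u * y₁ + v * y₂ + w * y₃ = 0)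
    (h₁ : a * x₁ ^ 2 + 2 * b * x₁ * y₁ + c * y₁ ^ 2 = 1)
    (h₂ : a * x₂ ^ 2 + 2 * b * x₂ * y₂ + c * y₂ ^ 2 = 1)
    (h₃ : a * x₃ ^ 2 + 2 * b * x₃ * y₃ + c * y₃ ^ 2 = 1) :
    2 * v * w * (a * x₂ * x₃ + b * (x₂ * y₃ + y₂ * x₃) + c * y₂ * y₃) = u ^ 2 - v ^ 2 - w ^ 2 := by
  have ex : u * x₁ = -(v * x₂ + w * x₃) := by linarith
  have ey : u * y₁ = -(v * y₂ + w * y₃) := by linarith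
  have key : a * (u * x₁) ^ 2 + 2 * b * (u * x₁) * (u * y₁) + c * (u * y₁) ^ 2 = u ^ 2 := by
    linear_combination u ^ 2 * h₁
  rw [ex, ey] at key
  linear_combination key - v ^ 2 * h₂ - w ^ 2 * h₃

/-- Three vectors with a linear relation are unit vectors for some positive definite form. -/
theorem exists_unit_form {u v w x₁ y₁ x y z t : ℝ} (hs : u + v + w = 1)
    (hx : u * x₁ + v * x + w * z = 0) (hy : u * y₁ + v * y + w * t = 0)
    (hu : u ≠ 0) (hv : v ≠ 0) (hw : w ≠ 0) (hk : x * t - y * z ≠ 0)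
    (hpos : 0 < (1 - 2 * u) * (1 - 2 * v) * (1 - 2 * w)) :
    ∃ a b c : ℝ, 0 < a ∧ 0 < a * c - b ^ 2 ∧ a * x₁ ^ 2 + 2 * b * x₁ * y₁ + c * y₁ ^ 2 = 1 ∧
      a * x ^ 2 + 2 * b * x * y + c * y ^ 2 = 1 ∧ a * z ^ 2 + 2 * b * z * t + c * t ^ 2 = 1 := by
  have hsu : u = 1 - v - w := by linarith
  -- `B` is the polar value of the last two vectors forced by `two_mul_polar_of_unit`.
  obtain ⟨B, hB⟩ : ∃ B, 2 * v * w * B = u ^ 2 - v ^ 2 - w ^ 2 :=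
    ⟨(u ^ 2 - v ^ 2 - w ^ 2) / (2 * v * w), by field_simp⟩
  have hB1 : 0 < 1 - B ^ 2 := by
    -- Heron's factorization; u + v + w = 1 turns its factors into 1, 1-2u, 1-2v, 1-2w.
    have h : (2 * v * w) ^ 2 * (1 - B ^ 2) = (1 - 2 * u) * (1 - 2 * v) * (1 - 2 * w) := by
      have : (2 * v * w) ^ 2 * (1 - B ^ 2) = (2 * v * w) ^ 2 - (2 * v * w * B) ^ 2 := by ring
      rw [this, hB, hsu]; ring
    rw [← h] at hpos
    exact pos_of_mul_pos_right hpos (sq_nonneg _)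
  have hyt : 0 < t ^ 2 + y ^ 2 - 2 * B * y * t := by
    have h0 : t ^ 2 + y ^ 2 - 2 * B * y * t = (t - B * y) ^ 2 + (1 - B ^ 2) * y ^ 2 := by ring
    rw [h0]
    by_cases hy0 : y = 0
    · have ht0 : t ≠ 0 := by
        rintro ht0
        apply hk
        rw [hy0, ht0]; ring
      rw [hy0]
      have := sq_pos_of_ne_zero ht0
      simpa using this
    · exact add_pos_of_nonneg_of_pos (sq_nonneg _) (mul_pos hB1 (sq_pos_of_ne_zero hy0))
  -- The form with Gram matrix (1, B; B, 1) on (x, y), (z, t), evaluated through Cramer coordinates;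
  -- `k` stands for the determinant.
  have hform : ∀ k p q : ℝ, (t ^ 2 + y ^ 2 - 2 * B * y * t) / k ^ 2 * p ^ 2
      + 2 * ((-(z * t + x * y) + B * (x * t + y * z)) / k ^ 2) * p * q
      + (z ^ 2 + x ^ 2 - 2 * B * x * z) / k ^ 2 * q ^ 2
      = ((p * t - q * z) ^ 2 + (x * q - y * p) ^ 2 + 2 * B * (p * t - q * z) * (x * q - y * p))
        / k ^ 2 := by
    intro k p q
    ring
  obtain ⟨k, hkk⟩ : ∃ k, k = x * t - y * z := ⟨_, rfl⟩
  rw [← hkk] at hk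
  have hk2 := sq_pos_of_ne_zero hk
  refine ⟨(t ^ 2 + y ^ 2 - 2 * B * y * t) / k ^ 2,
    (-(z * t + x * y) + B * (x * t + y * z)) / k ^ 2,
    (z ^ 2 + x ^ 2 - 2 * B * x * z) / k ^ 2, div_pos hyt hk2, ?_, ?_, ?_, ?_⟩
  · have : (t ^ 2 + y ^ 2 - 2 * B * y * t) / k ^ 2 * ((z ^ 2 + x ^ 2 - 2 * B * x * z) / k ^ 2)
        - ((-(z * t + x * y) + B * (x * t + y * z)) / k ^ 2) ^ 2
        = (1 - B ^ 2) * (x * t - y * z) ^ 2 / (k ^ 2) ^ 2 := by ring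
    rw [this, ← hkk]
    exact div_pos (mul_pos hB1 hk2) (pow_pos hk2 2)
  · rw [hform, div_eq_one_iff_eq hk2.ne']
    have e1 : u * (x₁ * t - y₁ * z) = -v * k := by
      rw [hkk]; linear_combination t * hx - z * hy
    have e2 : u * (x * y₁ - y * x₁) = -w * k := by
      rw [hkk]; linear_combination x * hy - y * hx
    apply mul_left_cancel₀ (pow_ne_zero 2 hu)
    calc _ = (u * (x₁ * t - y₁ * z)) ^ 2 + (u * (x * y₁ - y * x₁)) ^ 2
          + 2 * B * (u * (x₁ * t - y₁ * z)) * (u * (x * y₁ - y * x₁)) := by ring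
      _ = _ := by rw [e1, e2]; linear_combination k ^ 2 * hB
  · rw [hform, div_eq_one_iff_eq hk2.ne', hkk]
    ring
  · rw [hform, div_eq_one_iff_eq hk2.ne', hkk]
    ring

/-! ### Barycentric coordinates and circumellipses -/

/-- The signed area (doubled) of the triangle `XPQ`. -/
def cross (X P Q : Plane) : ℝ :=
  (P 0 - X 0) * (Q 1 - X 1) - (P 1 - X 1) * (Q 0 - X 0)

/-- The ratios `(u : v : w)`, normalized by `u + v + w = 1`, are the barycentric coordinates of `X`
with respect to the triangle `PQR`. -/
structure IsBarycentric (P Q R X : Plane) (u v w : ℝ) : Prop where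
  sum_eq : u + v + w = 1
  zero_eq : u * P 0 + v * Q 0 + w * R 0 = X 0
  one_eq : u * P 1 + v * Q 1 + w * R 1 = X 1

namespace IsBarycentric

variable {P Q R X : Plane} {u v w : ℝ}

theorem rotate (h : IsBarycentric P Q R X u v w) : IsBarycentric Q R P X v w u :=
  ⟨by linarith [h.sum_eq], by linarith [h.zero_eq], by linarith [h.one_eq]⟩

theorem cross_eq (h : IsBarycentric P Q R X u v w) : cross X Q R = u * cross P Q R := by
  have hs := h.sum_eq
  have hu : u = 1 - v - w := by linarith
  rw [cross, ← h.zero_eq, ← h.one_eq, cross, hu]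
  ring

theorem zero_rel (h : IsBarycentric P Q R X u v w) :
    u * (P 0 - X 0) + v * (Q 0 - X 0) + w * (R 0 - X 0) = 0 := by
  linear_combination h.zero_eq - X 0 * h.sum_eq

theorem one_rel (h : IsBarycentric P Q R X u v w) :
    u * (P 1 - X 1) + v * (Q 1 - X 1) + w * (R 1 - X 1) = 0 := by
  linear_combination h.one_eq - X 1 * h.sum_eq

/-- The discriminant of a circumellipse in terms of the barycentric coordinates of its center. -/
theorem disc_circumellipse (h : IsBarycentric P Q R X u v w) {C : Ellipse} (hC : C.center = X)
    (hP : P ∈ C.curve) (hQ : Q ∈ C.curve) (hR : R ∈ C.curve) :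
    (C.a * C.c - C.b ^ 2) * (2 * u * v * w * cross P Q R) ^ 2
      = (1 - 2 * u) * (1 - 2 * v) * (1 - 2 * w) := by
  subst hC
  have h1 := two_mul_polar_of_unit h.zero_rel h.one_rel hP hQ hR
  have h2 := quadratic_gram_det C.a C.b C.c (Q 0 - C.center 0) (Q 1 - C.center 1)
    (R 0 - C.center 0) (R 1 - C.center 1)
  have hQ' : C.form Q = 1 := hQ
  have hR' : C.form R = 1 := hR
  rw [Ellipse.form] at hQ' hR'
  rw [hQ', hR'] at h2
  have h3 := h.cross_eq
  rw [cross] at h3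
  rw [h3] at h2
  have hu : u = 1 - v - w := by linarith [h.sum_eq]
  calc _ = 4 * v ^ 2 * w ^ 2 * ((C.a * C.c - C.b ^ 2) * (u * cross P Q R) ^ 2) := by ring
    _ = 4 * v ^ 2 * w ^ 2 - (u ^ 2 - v ^ 2 - w ^ 2) ^ 2 := by rw [h2, ← h1]; ring
    _ = _ := by rw [hu]; ring

/-- The linear relation fixes the polar value at Q, R, hence the Gram matrix on a basis, hence the
form. -/
theorem circumellipse_unique (h : IsBarycentric P Q R X u v w) (hv : v ≠ 0) (hw : w ≠ 0)
    (hk : cross X Q R ≠ 0) {C C' : Ellipse} (hC : C.center = X) (hC' : C'.center = X)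
    (hP : P ∈ C.curve) (hQ : Q ∈ C.curve) (hR : R ∈ C.curve)
    (hP' : P ∈ C'.curve) (hQ' : Q ∈ C'.curve) (hR' : R ∈ C'.curve) : C = C' := by
  simp only [Ellipse.curve, Ellipse.form, Set.mem_ofPred_eq, hC, hC'] at hP hQ hR hP' hQ' hR'
  have hB := two_mul_polar_of_unit h.zero_rel h.one_rel hP hQ hR
  have hB' := two_mul_polar_of_unit h.zero_rel h.one_rel hP' hQ' hR'
  have hBB := mul_left_cancel₀ (mul_ne_zero (mul_ne_zero two_ne_zero hv) hw) (hB.trans hB'.symm)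
  obtain ⟨ha, hb, hc⟩ := quadratic_coeffs C.a C.b C.c (Q 0 - X 0) (Q 1 - X 1)
    (R 0 - X 0) (R 1 - X 1)
  obtain ⟨ha', hb', hc'⟩ := quadratic_coeffs C'.a C'.b C'.c (Q 0 - X 0) (Q 1 - X 1)
    (R 0 - X 0) (R 1 - X 1)
  rw [hQ, hR, hBB] at ha hb hc
  rw [hQ', hR'] at ha' hb' hc'
  have hk2 := pow_ne_zero 2 hk
  exact Ellipse.ext (hC.trans hC'.symm) (mul_left_cancel₀ hk2 (ha.trans ha'.symm))
    (mul_left_cancel₀ hk2 (hb.trans hb'.symm)) (mul_left_cancel₀ hk2 (hc.trans hc'.symm))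

theorem exists_circumellipse (h : IsBarycentric P Q R X u v w) (hu : u ≠ 0) (hv : v ≠ 0)
    (hw : w ≠ 0) (hD : cross P Q R ≠ 0) (hpos : 0 < (1 - 2 * u) * (1 - 2 * v) * (1 - 2 * w)) :
    ∃ C : Ellipse, C.center = X ∧ P ∈ C.curve ∧ Q ∈ C.curve ∧ R ∈ C.curve := by
  have hk : cross X Q R ≠ 0 := by rw [h.cross_eq]; exact mul_ne_zero hu hD
  obtain ⟨a, b, c, ha, hd, hP, hQ, hR⟩ :=
    exists_unit_form h.sum_eq h.zero_rel h.one_rel hu hv hw hk hpos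
  exact ⟨⟨X, a, b, c, ha, hd⟩, rfl, hP, hQ, hR⟩

end IsBarycentric

/-! ### Tangency and inellipses -/

theorem posDef_form_pos {a b c d e : ℝ} (ha : 0 < a) (hdisc : 0 < a * c - b ^ 2)
    (h : d ≠ 0 ∨ e ≠ 0) : 0 < a * d ^ 2 + 2 * b * d * e + c * e ^ 2 := by
  refine pos_of_mul_pos_right (a := a) ?_ ha.le
  have h0 : a * (a * d ^ 2 + 2 * b * d * e + c * e ^ 2)
      = (a * d + b * e) ^ 2 + (a * c - b ^ 2) * e ^ 2 := by ring
  rw [h0]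
  by_cases he : e = 0
  · have hd : a * d ≠ 0 := mul_ne_zero ha.ne' (h.resolve_right (not_not.2 he))
    have := sq_pos_of_ne_zero hd
    simpa [he] using this
  · exact add_pos_of_nonneg_of_pos (sq_nonneg _) (mul_pos hdisc (sq_pos_of_ne_zero he))

/-- A real quadratic polynomial taking the value `1` exactly once, at a point of `[0, 1]`. -/
theorem quadratic_tangent {A M p q s : ℝ} (hA : 0 < A) (hq : q = p + 2 * M + A) (hs0 : 0 ≤ s)
    (hs1 : s ≤ 1) (hroot : p + 2 * M * s + A * s ^ 2 = 1)
    (huniq : ∀ r, p + 2 * M * r + A * r ^ 2 = 1 → r = s) :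
    1 ≤ p ∧ 1 ≤ q ∧ p + M = 1 - √(p - 1) * √(q - 1) := by
  have hMs : M = -(A * s) := by
    -- By Vieta this is the other root, so `s` is a double root.
    have := huniq (-(2 * M / A) - s) (by rw [← hroot]; field_simp; ring)
    field_simp at this
    linarith
  have hp : p - 1 = A * s ^ 2 := by rw [hMs] at hroot; linarith
  have hq' : q - 1 = A * (1 - s) ^ 2 := by rw [hq, hMs]; linarith
  have hs1' : 0 ≤ 1 - s := by linarith
  have h1 := mul_nonneg hA.le (sq_nonneg s)
  have h2 := mul_nonneg hA.le (sq_nonneg (1 - s))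
  refine ⟨by linarith, by linarith, ?_⟩
  -- Since the contact point lies on the segment, the roots are √A s and √A (1 - s), which fixes the
  -- sign of their product.
  rw [hp, hq', Real.sqrt_mul hA.le, Real.sqrt_mul hA.le, Real.sqrt_sq hs0, Real.sqrt_sq hs1', hMs]
  linear_combination hp + s * (1 - s) * Real.mul_self_sqrt hA.le

theorem Ellipse.form_lineMap (E : Ellipse) (P Q : Plane) (r : ℝ) :
    E.form (AffineMap.lineMap P Q r) = E.form P
      + 2 * (E.a * (P 0 - E.center 0) * (Q 0 - P 0) + E.b * ((P 0 - E.center 0) * (Q 1 - P 1)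
        + (P 1 - E.center 1) * (Q 0 - P 0)) + E.c * (P 1 - E.center 1) * (Q 1 - P 1)) * r
      + (E.a * (Q 0 - P 0) ^ 2 + 2 * E.b * (Q 0 - P 0) * (Q 1 - P 1) + E.c * (Q 1 - P 1) ^ 2)
        * r ^ 2 := by
  have h (i : Fin 2) : (AffineMap.lineMap P Q r : Plane) i = r * (Q i - P i) + P i := by
    simp [AffineMap.lineMap_apply]
  rw [Ellipse.form, h, h, Ellipse.form]
  ring

/-- If `PQ` is tangent to the ellipse at a point of the segment, the Gram matrix of `P`, `Q` with
respect to the form of the ellipse is `1 + x²`, `1 - x y`, `1 + y²` with `x, y ≥ 0`. -/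
theorem SideTangent.gram {E : Ellipse} {P Q : Plane} (hPQ : P ≠ Q) (h : SideTangent E P Q) :
    1 ≤ E.form P ∧ 1 ≤ E.form Q ∧
    E.a * (P 0 - E.center 0) * (Q 0 - E.center 0)
      + E.b * ((P 0 - E.center 0) * (Q 1 - E.center 1) + (P 1 - E.center 1) * (Q 0 - E.center 0))
      + E.c * (P 1 - E.center 1) * (Q 1 - E.center 1)
      = 1 - √(E.form P - 1) * √(E.form Q - 1) := by
  obtain ⟨X, hX, hcap⟩ := h
  rw [segment_eq_image_lineMap] at hX
  obtain ⟨s, ⟨hs0, hs1⟩, rfl⟩ := hX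
  have hne : Q 0 - P 0 ≠ 0 ∨ Q 1 - P 1 ≠ 0 := by
    by_contra! hcon
    apply hPQ
    ext i
    fin_cases i
    · exact (sub_eq_zero.1 hcon.1).symm
    · exact (sub_eq_zero.1 hcon.2).symm
  have hmem : (AffineMap.lineMap P Q s : Plane) ∈ (line[ℝ, P, Q] : Set Plane) ∩ E.curve := by
    rw [hcap]; rfl
  have hroot : E.form (AffineMap.lineMap P Q s) = 1 := hmem.2
  rw [E.form_lineMap] at hroot
  obtain ⟨h1, h2, h3⟩ := quadratic_tangent (q := E.form Q)
    (posDef_form_pos E.a_pos E.disc_pos hne) (by rw [Ellipse.form, Ellipse.form]; ring)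
    hs0 hs1 hroot (fun r hr => by
      rw [← E.form_lineMap] at hr
      have hr' : (AffineMap.lineMap P Q r : Plane) ∈ (line[ℝ, P, Q] : Set Plane) ∩ E.curve :=
        ⟨AffineMap.lineMap_mem_affineSpan_pair _ _ _, hr⟩
      rw [hcap, Set.mem_singleton_iff] at hr'
      exact AffineMap.lineMap_injective ℝ hPQ hr')
  refine ⟨h1, h2, ?_⟩
  rw [← h3, Ellipse.form]
  ring

/-- The barycentric coordinates of the center of an inellipse. -/
theorem inellipse_weights {x₁ x₂ x₃ u v w : ℝ} (h₁ : 0 ≤ x₁) (h₂ : 0 ≤ x₂) (h₃ : 0 ≤ x₃)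
    (hs : u + v + w = 1)
    (e₁ : u * (1 + x₁ ^ 2) + v * (1 - x₁ * x₂) + w * (1 - x₁ * x₃) = 0)
    (e₂ : u * (1 - x₁ * x₂) + v * (1 + x₂ ^ 2) + w * (1 - x₂ * x₃) = 0)
    (e₃ : u * (1 - x₁ * x₃) + v * (1 - x₂ * x₃) + w * (1 + x₃ ^ 2) = 0) :
    0 < x₁ ∧ 0 < x₂ ∧ 0 < x₃ ∧ 2 * x₁ * x₂ * x₃ * u = x₂ + x₃ ∧
      2 * x₁ * x₂ * x₃ * v = x₃ + x₁ ∧ 2 * x₁ * x₂ * x₃ * w = x₁ + x₂ ∧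
      x₁ + x₂ + x₃ = x₁ * x₂ * x₃ := by
  -- Removing u + v + w = 1 leaves a nonzero right side, which excludes x₁ = 0. When E' is the unit
  -- circle, the xᵢ are the tangent lengths from the vertices.
  have f₁ : x₁ * (u * x₁ - v * x₂ - w * x₃) = -1 := by linear_combination e₁ - hs
  have f₂ : x₂ * (v * x₂ - u * x₁ - w * x₃) = -1 := by linear_combination e₂ - hs
  have f₃ : x₃ * (w * x₃ - u * x₁ - v * x₂) = -1 := by linear_combination e₃ - hs
  have n₁ : x₁ ≠ 0 := by rintro rfl; norm_num at f₁
  have n₂ : x₂ ≠ 0 := by rintro rfl; norm_num at f₂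
  have n₃ : x₃ ≠ 0 := by rintro rfl; norm_num at f₃
  have g₁ : 2 * x₁ * x₂ * x₃ * u = x₂ + x₃ := by
    linear_combination (-x₃) * f₂ - x₂ * f₃
  have g₂ : 2 * x₁ * x₂ * x₃ * v = x₃ + x₁ := by
    linear_combination (-x₃) * f₁ - x₁ * f₃
  have g₃ : 2 * x₁ * x₂ * x₃ * w = x₁ + x₂ := by
    linear_combination (-x₂) * f₁ - x₁ * f₂
  exact ⟨lt_of_le_of_ne h₁ n₁.symm, lt_of_le_of_ne h₂ n₂.symm, lt_of_le_of_ne h₃ n₃.symm,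
    g₁, g₂, g₃, by linear_combination (-1 / 2) * (g₁ + g₂ + g₃) + x₁ * x₂ * x₃ * hs⟩

/-- A triangle is non-degenerate iff its signed area does not vanish. -/
theorem affineIndependent_iff_cross_ne_zero (p : Fin 3 → Plane) :
    AffineIndependent ℝ p ↔ cross (p 0) (p 1) (p 2) ≠ 0 := by
  have hfun : (fun i : {x : Fin 3 // x ≠ 0} => p i -ᵥ p 0) ∘ finSuccAboveEquiv (0 : Fin 3)
      = ![p 1 - p 0, p 2 - p 0] := by
    funext i
    fin_cases i <;> rfl
  rw [affineIndependent_iff_linearIndependent_vsub ℝ p 0,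
    ← linearIndependent_equiv (finSuccAboveEquiv (0 : Fin 3)), hfun, LinearIndependent.pair_iff,
    cross]
  constructor
  · intro h hD
    -- A zero determinant makes each coordinate row supply a dependency; independence then kills the
    -- first vector.
    have h1 := h (p 2 1 - p 0 1) (-(p 1 1 - p 0 1)) (by
      ext i
      fin_cases i
      · simp; linear_combination hD
      · simp; ring)
    have h2 := h (p 2 0 - p 0 0) (-(p 1 0 - p 0 0)) (by
      ext i
      fin_cases i
      · simp; ring
      · simp; linear_combination -hD)
    have h3 := h 1 0 (by
      ext i
      fin_cases i
      · simp; linarith [h2.2]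
      · simp; linarith [h1.2])
    exact one_ne_zero h3.1
  · intro hD s t hst
    have h0 : s * (p 1 0 - p 0 0) + t * (p 2 0 - p 0 0) = 0 := by
      simpa using congrArg (fun z : Plane => z 0) hst
    have h1 : s * (p 1 1 - p 0 1) + t * (p 2 1 - p 0 1) = 0 := by
      simpa using congrArg (fun z : Plane => z 1) hst
    constructor
    · refine (mul_eq_zero.1 ?_).resolve_right hD
      linear_combination (p 2 1 - p 0 1) * h0 - (p 2 0 - p 0 0) * h1
    · refine (mul_eq_zero.1 ?_).resolve_right hD
      linear_combination (p 1 0 - p 0 0) * h1 - (p 1 1 - p 0 1) * h0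

/-- The barycentric coordinates `(u : v : w)` of the center of an inellipse lie in `(0, 1/2)`, and
they determine the discriminant of the inellipse. -/
theorem inellipse_of_sideTangent {P Q R : Plane} {E : Ellipse} {u v w : ℝ}
    (h : IsBarycentric P Q R E.center u v w) (hD : cross P Q R ≠ 0)
    (hP : SideTangent E Q R) (hQ : SideTangent E R P) (hR : SideTangent E P Q) :
    0 < u ∧ u < 1 / 2 ∧ 0 < v ∧ v < 1 / 2 ∧ 0 < w ∧ w < 1 / 2 ∧
      (E.a * E.c - E.b ^ 2) * cross P Q R ^ 2 * ((1 - 2 * u) * (1 - 2 * v) * (1 - 2 * w)) = 4 := by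
  have nPQ : P ≠ Q := by rintro rfl; exact hD (by simp [cross])
  have nQR : Q ≠ R := by rintro rfl; exact hD (by rw [cross]; ring)
  have nRP : R ≠ P := by rintro rfl; exact hD (by simp [cross])
  obtain ⟨q1, r1, gQR⟩ := hP.gram nQR
  obtain ⟨-, p1, gRP⟩ := hQ.gram nRP
  obtain ⟨-, -, gPQ⟩ := hR.gram nPQ
  have sP := Real.sq_sqrt (sub_nonneg.2 p1)
  have sQ := Real.sq_sqrt (sub_nonneg.2 q1)
  have sR := Real.sq_sqrt (sub_nonneg.2 r1)
  have zP := Real.sqrt_nonneg (E.form P - 1)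
  have zQ := Real.sqrt_nonneg (E.form Q - 1)
  have zR := Real.sqrt_nonneg (E.form R - 1)
  have hgram := quadratic_gram_det E.a E.b E.c (Q 0 - E.center 0) (Q 1 - E.center 1)
    (R 0 - E.center 0) (R 1 - E.center 1)
  rw [gQR] at hgram
  change _ = E.form Q * E.form R - _ at hgram
  have hc := h.cross_eq
  rw [cross] at hc
  rw [hc] at hgram
  generalize √(E.form P - 1) = x₁ at *
  generalize √(E.form Q - 1) = x₂ at *
  generalize √(E.form R - 1) = x₃ at *
  have fP : E.form P = 1 + x₁ ^ 2 := by linarith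
  have fQ : E.form Q = 1 + x₂ ^ 2 := by linarith
  have fR : E.form R = 1 + x₃ ^ 2 := by linarith
  rw [fQ, fR] at hgram
  rw [Ellipse.form] at fP fQ fR
  have hx := h.zero_rel
  have hy := h.one_rel
  obtain ⟨x1, x2, x3, g1, g2, g3, hs⟩ := inellipse_weights zP zQ zR h.sum_eq
    (by
      rw [← fP, ← gPQ, mul_comm x₁ x₃, ← gRP]
      linear_combination (E.a * (P 0 - E.center 0) + E.b * (P 1 - E.center 1)) * hx
        + (E.b * (P 0 - E.center 0) + E.c * (P 1 - E.center 1)) * hy)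
    (by
      rw [← fQ, ← gPQ, ← gQR]
      linear_combination (E.a * (Q 0 - E.center 0) + E.b * (Q 1 - E.center 1)) * hx
        + (E.b * (Q 0 - E.center 0) + E.c * (Q 1 - E.center 1)) * hy)
    (by
      rw [← fR, ← gQR, mul_comm x₁ x₃, ← gRP]
      linear_combination (E.a * (R 0 - E.center 0) + E.b * (R 1 - E.center 1)) * hx
        + (E.b * (R 0 - E.center 0) + E.c * (R 1 - E.center 1)) * hy)
  -- The identity x₁ + x₂ + x₃ = x₁x₂x₃ turns `g1` into 1 - 2u = 1/(x₂x₃).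
  have u1 : x₂ * x₃ * (1 - 2 * u) = 1 := by
    apply mul_left_cancel₀ x1.ne'
    linear_combination -g1 - hs
  have v1 : x₃ * x₁ * (1 - 2 * v) = 1 := by
    apply mul_left_cancel₀ x2.ne'
    linear_combination -g2 - hs
  have w1 : x₁ * x₂ * (1 - 2 * w) = 1 := by
    apply mul_left_cancel₀ x3.ne'
    linear_combination -g3 - hs
  have u0 : 0 < u := pos_of_mul_pos_right (by rw [g1]; positivity)
    (by positivity : 0 ≤ 2 * x₁ * x₂ * x₃)
  have v0 : 0 < v := pos_of_mul_pos_right (by rw [g2]; positivity)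
    (by positivity : 0 ≤ 2 * x₁ * x₂ * x₃)
  have w0 : 0 < w := pos_of_mul_pos_right (by rw [g3]; positivity)
    (by positivity : 0 ≤ 2 * x₁ * x₂ * x₃)
  have u2 : 0 < 1 - 2 * u := pos_of_mul_pos_right (by rw [u1]; positivity)
    (by positivity : 0 ≤ x₂ * x₃)
  have v2 : 0 < 1 - 2 * v := pos_of_mul_pos_right (by rw [v1]; positivity)
    (by positivity : 0 ≤ x₃ * x₁)
  have w2 : 0 < 1 - 2 * w := pos_of_mul_pos_right (by rw [w1]; positivity)
    (by positivity : 0 ≤ x₁ * x₂)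
  refine ⟨u0, by linarith, v0, by linarith, w0, by linarith, ?_⟩
  have hprod : (x₁ * x₂ * x₃) ^ 2 * ((1 - 2 * u) * (1 - 2 * v) * (1 - 2 * w)) = 1 := by
    calc _ = (x₂ * x₃ * (1 - 2 * u)) * (x₃ * x₁ * (1 - 2 * v)) * (x₁ * x₂ * (1 - 2 * w)) := by ring
      _ = 1 := by rw [u1, v1, w1]; norm_num
  -- (1 + x₂²)(1 + x₃²) - (1 - x₂x₃)² = (x₂ + x₃)².
  have hdisc : (E.a * E.c - E.b ^ 2) * (u * cross P Q R) ^ 2 = (x₂ + x₃) ^ 2 := by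
    rw [hgram]; ring
  apply mul_left_cancel₀ (pow_ne_zero 2 u0.ne')
  rw [← g1] at hdisc
  calc _ = (E.a * E.c - E.b ^ 2) * (u * cross P Q R) ^ 2
        * ((1 - 2 * u) * (1 - 2 * v) * (1 - 2 * w)) := by ring
    _ = 4 * u ^ 2 * ((x₁ * x₂ * x₃) ^ 2 * ((1 - 2 * u) * (1 - 2 * v) * (1 - 2 * w))) := by
      rw [hdisc]; ring
    _ = _ := by rw [hprod]; ring

/-! ### The anticevian triangle -/

theorem lineMap_plane_apply (P Q : Plane) (r : ℝ) (i : Fin 2) :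
    (AffineMap.lineMap P Q r : Plane) i = r * (Q i - P i) + P i := by
  simp [AffineMap.lineMap_apply]

/-- The anticevian vertex on the line `PX`, where `u` is the barycentric coordinate of `X` at
`P`. -/
noncomputable def anticevianPoint (P X : Plane) (u : ℝ) : Plane :=
  AffineMap.lineMap X P (-(2 * u) / (1 - 2 * u))

theorem anticevianPoint_apply (P X : Plane) (u : ℝ) (i : Fin 2) :
    anticevianPoint P X u i = -(2 * u) / (1 - 2 * u) * (P i - X i) + X i :=
  lineMap_plane_apply _ _ _ _

theorem mem_line_anticevianPoint {P X : Plane} {u : ℝ} (hu : u ≠ 0) (hu' : 1 - 2 * u ≠ 0) :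
    P ∈ line[ℝ, anticevianPoint P X u, X] := by
  rw [mem_affineSpan_pair_iff_exists_lineMap_eq]
  refine ⟨1 / (2 * u), ?_⟩
  ext i
  rw [lineMap_plane_apply, anticevianPoint_apply]
  field_simp
  ring

namespace IsBarycentric

variable {P Q R X : Plane} {u v w : ℝ}

theorem rel (h : IsBarycentric P Q R X u v w) (i : Fin 2) :
    u * (P i - X i) + v * (Q i - X i) + w * (R i - X i) = 0 := by
  fin_cases i
  exacts [h.zero_rel, h.one_rel]

/-- (u : -v : w) + (u : v : -w) = (2u : 0 : 0), so P is the mean of the two vertices with weights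
1-2v and 1-2w, of total 2u. -/
theorem mem_side_anticevianPoint (h : IsBarycentric P Q R X u v w) (hu : u ≠ 0)
    (hv : 1 - 2 * v ≠ 0) (hw : 1 - 2 * w ≠ 0) :
    P ∈ line[ℝ, anticevianPoint Q X v, anticevianPoint R X w] := by
  rw [mem_affineSpan_pair_iff_exists_lineMap_eq]
  refine ⟨(1 - 2 * w) / (2 * u), ?_⟩
  ext i
  have hi := h.rel i
  have hs : u = 1 - v - w := by linarith [h.sum_eq]
  apply mul_left_cancel₀ hu
  have e1 : (1 - 2 * v) * (anticevianPoint Q X v i - X i) = -(2 * v) * (Q i - X i) := by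
    rw [anticevianPoint_apply]; field_simp; ring
  have e2 : (1 - 2 * w) * (anticevianPoint R X w i - X i) = -(2 * w) * (R i - X i) := by
    rw [anticevianPoint_apply]; field_simp; ring
  rw [lineMap_plane_apply]
  generalize anticevianPoint Q X v i = q at *
  generalize anticevianPoint R X w i = r at *
  have : u * ((1 - 2 * w) / (2 * u) * (r - q) + q) = (1 - 2 * w) / 2 * (r - q) + u * q := by
    field_simp
  rw [this]
  linear_combination (1 / 2) * e1 + (1 / 2) * e2 - hi + (q - X i) * hs

/-- Menelaus-type relation: if `Q'`, `R'` are on the lines `QX`, `RX` and `P` is on the line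
`Q'R'`, then the ratios are constrained. -/
theorem cevian_ratio_rel (h : IsBarycentric P Q R X u v w) (hk : cross X Q R ≠ 0) {Q' R' : Plane}
    {m n s : ℝ} (hm : m ≠ 0) (hn : n ≠ 0) (hQ : ∀ i, Q i - X i = m * (Q' i - X i))
    (hR : ∀ i, R i - X i = n * (R' i - X i)) (hP : AffineMap.lineMap Q' R' s = P) :
    v * m + w * n = -u := by
  -- Putting P on Q'R' into the barycentric relation leaves a relation between the independent Q - X
  -- and R - X. Both coefficients vanish, and their sum eliminates `s`.
  have key (i : Fin 2) : (m * v + u * (1 - s)) * n * (Q i - X i)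
      + (n * w + u * s) * m * (R i - X i) = 0 := by
    have hi := h.rel i
    rw [← hP, lineMap_plane_apply] at hi
    have h1 := hQ i
    have h2 := hR i
    linear_combination m * n * hi + u * (1 - s) * n * h1 + u * s * m * h2
  have k0 := key 0
  have k1 := key 1
  rw [cross] at hk
  have hq : m * v + u * (1 - s) = 0 := by
    refine (mul_eq_zero.1 ((mul_eq_zero.1 ?_).resolve_right hk)).resolve_right hn
    linear_combination (R 1 - X 1) * k0 - (R 0 - X 0) * k1
  have hr : n * w + u * s = 0 := by
    refine (mul_eq_zero.1 ((mul_eq_zero.1 ?_).resolve_right hk)).resolve_right hm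
    linear_combination (Q 0 - X 0) * k1 - (Q 1 - X 1) * k0
  linear_combination hq + hr

theorem anticevianPoint (h : IsBarycentric P Q R X u v w) (hu : 1 - 2 * u ≠ 0) :
    IsBarycentric P Q R (anticevianPoint P X u) (-u / (1 - 2 * u)) (v / (1 - 2 * u))
      (w / (1 - 2 * u)) := by
  have hs : v + w = 1 - u := by linarith [h.sum_eq]
  have hr := inv_mul_cancel₀ hu
  have key (i : Fin 2) : -u / (1 - 2 * u) * P i + v / (1 - 2 * u) * Q i + w / (1 - 2 * u) * R i
      = -(2 * u) / (1 - 2 * u) * (P i - X i) + X i := by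
    simp only [div_eq_mul_inv]
    linear_combination (1 - 2 * u)⁻¹ * h.rel i + (1 - 2 * u)⁻¹ * X i * hs + X i * hr
  refine ⟨by simp only [div_eq_mul_inv]; linear_combination (1 - 2 * u)⁻¹ * hs + hr, ?_, ?_⟩ <;> rw [anticevianPoint_apply, key]

/-- Cut the area from X: each of the three pieces scales by the product of two stretching factors.
-/
theorem cross_anticevianPoint (h : IsBarycentric P Q R X u v w) (hu : 1 - 2 * u ≠ 0)
    (hv : 1 - 2 * v ≠ 0) (hw : 1 - 2 * w ≠ 0) :
    cross (_root_.anticevianPoint P X u) (_root_.anticevianPoint Q X v)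
        (_root_.anticevianPoint R X w) * ((1 - 2 * u) * (1 - 2 * v) * (1 - 2 * w))
      = 4 * u * v * w * cross P Q R := by
  have expand (l m n : ℝ) {P' Q' R' : Plane} (hP : ∀ i, P' i = l * (P i - X i) + X i)
      (hQ : ∀ i, Q' i = m * (Q i - X i) + X i) (hR : ∀ i, R' i = n * (R i - X i) + X i) :
      cross P' Q' R' = m * n * cross X Q R + n * l * cross X R P + l * m * cross X P Q := by
    simp only [cross, hP, hQ, hR]
    ring
  rw [expand _ _ _ (anticevianPoint_apply P X u) (anticevianPoint_apply Q X v)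
    (anticevianPoint_apply R X w), h.cross_eq, h.rotate.cross_eq, h.rotate.rotate.cross_eq]
  have e1 : cross Q R P = cross P Q R := by simp only [cross]; ring
  have e2 : cross R P Q = cross P Q R := by simp only [cross]; ring
  rw [e1, e2]
  field_simp
  linear_combination (-8 * u * v * w * cross P Q R) * h.sum_eq

end IsBarycentric

/-- In a triangle with barycentric coordinates `w` of `O`, the anticevian triangle has the expected
vertices. -/
theorem isAnticevian_iff {T T' : Affine.Triangle ℝ Plane} {O : Plane} {w : Fin 3 → ℝ}
    (h : ∀ i, IsBarycentric (T.points i) (T.points (i + 1)) (T.points (i + 2)) O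
      (w i) (w (i + 1)) (w (i + 2)))
    (hw : ∀ i, w i ≠ 0) (hw' : ∀ i, 1 - 2 * w i ≠ 0)
    (hk : ∀ i, cross O (T.points (i + 1)) (T.points (i + 2)) ≠ 0) :
    IsAnticevian T O T' ↔ ∀ i, T'.points i = anticevianPoint (T.points i) O (w i) := by
  constructor
  · intro hA
    have hν : ∀ i, ∃ m : ℝ, m ≠ 0 ∧
        ∀ j, T.points i j - O j = m * (T'.points i j - O j) := by
      intro i
      obtain ⟨r, hr⟩ :=
          mem_affineSpan_pair_iff_exists_lineMap_eq.1 (hA i).1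
      have hm (j : Fin 2) : T.points i j - O j = (1 - r) * (T'.points i j - O j) := by
        rw [← hr, lineMap_plane_apply]; ring
      refine ⟨1 - r, fun h0 => ?_, hm⟩
      have hki : cross O (T.points i) (T.points (i + 1)) ≠ 0 := by
        have := hk (i + 2)
        have e1 : i + 2 + 1 = i := by fin_cases i <;> rfl
        have e2 : i + 2 + 2 = i + 1 := by fin_cases i <;> rfl
        rwa [e1, e2] at this
      apply hki
      rw [cross, hm 0, hm 1, h0]; ring
    choose m hm hmT using hν
    have hrel (i : Fin 3) : w (i + 1) * m (i + 1) + w (i + 2) * m (i + 2) = -w i := by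
      obtain ⟨s, hs⟩ :=
          mem_affineSpan_pair_iff_exists_lineMap_eq.1 (hA i).2
      exact (h i).cevian_ratio_rel (hk i) (hm _) (hm _) (hmT _) (hmT _) hs
    -- The three Menelaus relations are linear in the products `w i * m i` and determine them.
    have hval (i : Fin 3) : 2 * w i * m i = 2 * w i - 1 := by
      have r0 := hrel i
      have r1 := hrel (i + 1)
      have r2 := hrel (i + 2)
      have e1 : i + 1 + 1 = i + 2 := by fin_cases i <;> rfl
      have e2 : i + 1 + 2 = i := by fin_cases i <;> rfl
      have e3 : i + 2 + 1 = i := by fin_cases i <;> rfl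
      have e4 : i + 2 + 2 = i + 1 := by fin_cases i <;> rfl
      rw [e1, e2] at r1
      rw [e3, e4] at r2
      have := (h i).sum_eq
      linear_combination r1 + r2 - r0 - this
    intro i
    ext j
    rw [anticevianPoint_apply, hmT i j]
    have := hw' i
    field_simp
    linear_combination (T'.points i j - O j) * hval i
  · intro hT' i
    rw [hT', hT', hT']
    exact ⟨mem_line_anticevianPoint (hw i) (hw' i),
      (h i).mem_side_anticevianPoint (hw i) (hw' _) (hw' _)⟩

theorem isCircumellipse_iff_rotate (T : Affine.Triangle ℝ Plane) (X : Plane) (C : Ellipse)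
    (i : Fin 3) : IsCircumellipse T X C ↔ C.center = X ∧ T.points i ∈ C.curve ∧
      T.points (i + 1) ∈ C.curve ∧ T.points (i + 2) ∈ C.curve := by
  refine ⟨fun h => ⟨h.1, h.2 _, h.2 _, h.2 _⟩, fun ⟨hX, h0, h1, h2⟩ => ⟨hX, fun j => ?_⟩⟩
  have : j = i ∨ j = i + 1 ∨ j = i + 2 := by
    fin_cases i <;> fin_cases j <;> decide
  rcases this with rfl | rfl | rfl <;> assumption

/-! ### Circumellipses centered at anticevian vertices -/

namespace IsBarycentric

variable {P Q R X : Plane} {u v w : ℝ}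

theorem existsUnique_circumellipse (h : IsBarycentric P Q R X u v w) (hu : u ≠ 0) (hv : v ≠ 0)
    (hw : w ≠ 0) (hD : cross P Q R ≠ 0) (hpos : 0 < (1 - 2 * u) * (1 - 2 * v) * (1 - 2 * w)) :
    ∃! C : Ellipse, C.center = X ∧ P ∈ C.curve ∧ Q ∈ C.curve ∧ R ∈ C.curve := by
  obtain ⟨C, hC⟩ := h.exists_circumellipse hu hv hw hD hpos
  have hk : cross X Q R ≠ 0 := by rw [h.cross_eq]; exact mul_ne_zero hu hD
  exact ⟨C, hC, fun C' hC' => h.circumellipse_unique hv hw hk hC'.1 hC.1 hC'.2.1 hC'.2.2.1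
    hC'.2.2.2 hC.2.1 hC.2.2.1 hC.2.2.2⟩

/-- With s = 1-2u the factors are 1/s, (2w-1)/s, (2v-1)/s; the two sign changes cancel, so
positivity survives. -/
theorem anticevianPoint_prod (h : IsBarycentric P Q R X u v w) (hu : 1 - 2 * u ≠ 0) :
    (1 - 2 * (-u / (1 - 2 * u))) * (1 - 2 * (v / (1 - 2 * u))) * (1 - 2 * (w / (1 - 2 * u)))
      = (1 - 2 * u) * (1 - 2 * v) * (1 - 2 * w) / (1 - 2 * u) ^ 4 := by
  have hs : v = 1 - u - w := by linarith [h.sum_eq]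
  rw [hs]
  field_simp
  ring

/-- The circumellipse centered at the anticevian vertex on `PX` has area `1 / (1 - 2 u)` times the
area of the circumellipse centered at `X`. -/
theorem area_circumellipse_anticevianPoint (h : IsBarycentric P Q R X u v w) (hu : u ≠ 0)
    (hv : v ≠ 0) (hw : w ≠ 0) (hs : 0 < 1 - 2 * u) (hD : cross P Q R ≠ 0) {E C : Ellipse}
    (hE : E.center = X ∧ P ∈ E.curve ∧ Q ∈ E.curve ∧ R ∈ E.curve)
    (hC : C.center = _root_.anticevianPoint P X u ∧ P ∈ C.curve ∧ Q ∈ C.curve ∧ R ∈ C.curve) :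
    C.area = E.area * (1 / (1 - 2 * u)) := by
  have h1 := h.disc_circumellipse hE.1 hE.2.1 hE.2.2.1 hE.2.2.2
  have h2 := (h.anticevianPoint hs.ne').disc_circumellipse hC.1 hC.2.1 hC.2.2.1 hC.2.2.2
  rw [h.anticevianPoint_prod hs.ne', ← h1] at h2
  -- The product of the new coordinates, squared, brings s⁻⁶ against s⁻⁴ on the right, for s = 1-2u.
  have h3 : C.a * C.c - C.b ^ 2 = (1 - 2 * u) ^ 2 * (E.a * E.c - E.b ^ 2) := by
    have hne : (2 * u * v * w * cross P Q R) ^ 2 ≠ 0 := by positivity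
    apply mul_right_cancel₀ hne
    have hs' := hs.ne'
    field_simp at h2
    rw [h2]
  rw [C.area_eq, E.area_eq, h3, Real.sqrt_mul (sq_nonneg _), Real.sqrt_sq hs.le]
  have := (Real.sqrt_pos.2 E.disc_pos).ne'
  field_simp

end IsBarycentric

/-! ### The invariant sum -/

/-- The area factors of the anticevian circumellipses, summed, in terms of the discriminants of a
concentric circumellipse and inellipse. -/
theorem sum_inv_eq {d d' D u v w : ℝ} (hs : u + v + w = 1) (hu : 0 < u) (hv : 0 < v) (hw : 0 < w)
    (hu' : 0 < 1 - 2 * u) (hv' : 0 < 1 - 2 * v) (hw' : 0 < 1 - 2 * w) (hD : D ≠ 0) (hd : 0 < d)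
    (h : d * (2 * u * v * w * D) ^ 2 = (1 - 2 * u) * (1 - 2 * v) * (1 - 2 * w))
    (h' : d' * D ^ 2 * ((1 - 2 * u) * (1 - 2 * v) * (1 - 2 * w)) = 4) :
    1 / (1 - 2 * u) + 1 / (1 - 2 * v) + 1 / (1 - 2 * w) = 1 + 2 * √(d' / d) := by
  have hdd : d' / d = (4 * u * v * w / ((1 - 2 * u) * (1 - 2 * v) * (1 - 2 * w))) ^ 2 := by
    rw [div_pow, div_eq_div_iff hd.ne' (by positivity)]
    apply mul_right_cancel₀ (pow_ne_zero 2 hD)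
    linear_combination (1 - 2 * u) * (1 - 2 * v) * (1 - 2 * w) * h' - 4 * h
  rw [hdd, Real.sqrt_sq (by positivity)]
  -- What remains is Σ (1-2v)(1-2w) = (1-2u)(1-2v)(1-2w) + 8uvw.
  obtain rfl : w = 1 - u - v := by linarith
  field_simp
  ring

theorem mainTheorem1 (E E' : Ellipse) (O : Plane) (hE : E.center = O) (hE' : E'.center = O)
    (hne : (ponceletFamily E E').Nonempty) :
    ∃ S : ℝ, ∀ T ∈ ponceletFamily E E',
      (∃! T' : Affine.Triangle ℝ Plane, IsAnticevian T O T') ∧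
      ∀ T' : Affine.Triangle ℝ Plane, IsAnticevian T O T' →
        (∀ i, ∃! C : Ellipse, IsCircumellipse T (T'.points i) C) ∧
        ∀ C : Fin 3 → Ellipse, (∀ i, IsCircumellipse T (T'.points i) (C i)) →
          ∑ i, (C i).area = S := by
  -- By `area_eq` the root is area(E)/area(E').
  refine ⟨E.area * (1 + 2 * √((E'.a * E'.c - E'.b ^ 2) / (E.a * E.c - E.b ^ 2))), ?_⟩
  rintro T ⟨hin, htan⟩
  have hD := (affineIndependent_iff_cross_ne_zero _).1 T.independent
  obtain ⟨w, hwdef⟩ : ∃ w : Fin 3 → ℝ, ∀ i, w i =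
      cross O (T.points (i + 1)) (T.points (i + 2))
        / cross (T.points 0) (T.points 1) (T.points 2) := ⟨_, fun _ => rfl⟩
  have h0 : IsBarycentric (T.points 0) (T.points 1) (T.points 2) O (w 0) (w 1) (w 2) := by
    have w0 : w 0 = cross O (T.points 1) (T.points 2) / _ := hwdef 0
    have w1 : w 1 = cross O (T.points 2) (T.points 0) / _ := hwdef 1
    have w2 : w 2 = cross O (T.points 0) (T.points 1) / _ := hwdef 2
    rw [w0, w1, w2]
    refine ⟨?_, ?_, ?_⟩ <;> field_simp <;> simp only [cross] <;> ring
  have h : ∀ i, IsBarycentric (T.points i) (T.points (i + 1)) (T.points (i + 2)) O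
      (w i) (w (i + 1)) (w (i + 2)) := by
    intro i
    fin_cases i
    exacts [h0, h0.rotate, h0.rotate.rotate]
  have hDi : ∀ i, cross (T.points i) (T.points (i + 1)) (T.points (i + 2)) ≠ 0 := by
    intro i
    convert hD using 1
    fin_cases i
    · rfl
    · change cross (T.points 1) (T.points 2) (T.points 0) = _
      simp only [cross]; ring
    · change cross (T.points 2) (T.points 0) (T.points 1) = _
      simp only [cross]; ring
  obtain ⟨p0, q0, p1, q1, p2, q2, hdisc'⟩ :=
    inellipse_of_sideTangent (hE'.symm ▸ h0) hD (htan 0) (htan 1) (htan 2)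
  have hpos : ∀ i, 0 < w i := by
    intro i
    fin_cases i
    exacts [p0, p1, p2]
  have hpos' : ∀ i, 0 < 1 - 2 * w i := by
    intro i
    fin_cases i
    exacts [show 0 < 1 - 2 * w 0 by linarith, show 0 < 1 - 2 * w 1 by linarith,
      show 0 < 1 - 2 * w 2 by linarith]
  have hiff (T' : Affine.Triangle ℝ Plane) := isAnticevian_iff (T' := T') h
    (fun i => (hpos i).ne') (fun i => (hpos' i).ne')
    (fun i => by rw [(h i).cross_eq]; exact mul_ne_zero (hpos i).ne' (hDi i))
  refine ⟨⟨⟨fun i => anticevianPoint (T.points i) O (w i), ?_⟩, ?_, ?_⟩, ?_⟩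
  · rw [affineIndependent_iff_cross_ne_zero]
    refine left_ne_zero_of_mul (b := (1 - 2 * w 0) * (1 - 2 * w 1) * (1 - 2 * w 2)) ?_
    rw [h0.cross_anticevianPoint (hpos' 0).ne' (hpos' 1).ne' (hpos' 2).ne']
    have := hpos 0; have := hpos 1; have := hpos 2
    positivity
  · exact (hiff _).2 fun _ => rfl
  · intro T' hT'
    ext i j
    exact congrArg (fun P : Plane => P j) ((hiff T').1 hT' i)
  · intro T' hT'
    rw [hiff] at hT'
    constructor
    · intro i
      simp only [isCircumellipse_iff_rotate T _ _ i, hT']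
      have s := hpos' i
      have a := hpos i
      have b := hpos (i + 1)
      have c := hpos (i + 2)
      refine ((h i).anticevianPoint s.ne').existsUnique_circumellipse
        (div_ne_zero (neg_ne_zero.2 a.ne') s.ne')
        (by positivity) (by positivity) (hDi i) ?_
      rw [(h i).anticevianPoint_prod s.ne']
      have := hpos' (i + 1)
      have := hpos' (i + 2)
      positivity
    · intro C hC
      have hCi (i : Fin 3) : (C i).area = E.area * (1 / (1 - 2 * w i)) :=
        (h i).area_circumellipse_anticevianPoint (hpos i).ne' (hpos _).ne' (hpos _).ne' (hpos' i)
          (hDi i) ⟨hE, hin _, hin _, hin _⟩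
          (hT' i ▸ (isCircumellipse_iff_rotate T _ _ i).1 (hC i))
      rw [Fin.sum_univ_three, hCi, hCi, hCi, ← mul_add, ← mul_add,
        sum_inv_eq h0.sum_eq (hpos 0) (hpos 1) (hpos 2) (hpos' 0) (hpos' 1) (hpos' 2) hD
          E.disc_pos (h0.disc_circumellipse hE (hin 0) (hin 1) (hin 2)) hdisc']
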